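/- For a positive integer $N$ let $r_3(N)$ be the largest size of a subset of $\{1,\ldots,N\}$ that contains no non-trivial three-term arithmetic progression, that is, no triple $(x,x+d,x+2d)$ with $d\neq 0$. Let $\log$ be the natural logarithm. Then there is a function $\omega$ from the non-negative integers to the reals with $\omega(N)\to\infty$ as $N\to\infty$ such that $$ r_3(N)\le \frac{N}{(\log\log N)^{\omega(N)}}\qquad\text{for every integer } N\ge 3. $$ Equivalently, for every $c>0$ there are $C>0$ and an integer $N_0\ge 3$ (both depending only on $c$) such that $$ r_3(N)\le \frac{C\,N}{(\log\log N)^{c}}\qquad\text{for all integers } N\ge N_0. $$ -/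

import Mathlib

/-- `r₃(N)`: the largest size of a subset of `{1, …, N}` that contains no three-term arithmetic
progression `x, x + d, x + 2d` with `d ≠ 0`. -/
def rThree (N : ℕ) : ℕ := addRothNumber (Finset.Icc 1 N)

open Finset

/-! Let r be the Roth number of an interval, α = r(N)/N, and A an extremal set. By Parseval, A has
only O(α⁻³) large Fourier coefficients modulo a prime p comparable to N, so Dirichlet approximation
gives d ≠ 0 for which all of them have nearly trivial phase on small multiples of d. Hence A has
hardly more solutions of x + z - 2y = td, for small t, than of x + z = 2y, which has only the #A
trivial ones (`exists_difference_solutionCount_le`).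

Suppose r(L) < (41/40)αL. A progression of length L and difference d meets A in at most r(L) points.
The average is about αL, so most meet A in at least αL/2 points, and triples of these with starts x,
x + e, x + 2e give too many solutions. So r(L)/L ≥ (41/40)α whenever log L is at most roughly α³ log
N (`rothNumberNat_increment`).

Each step gains a constant factor in density and costs log N only a power of α. As densities are at
most 1, iterating bounds log log N by O(log²(2/α)), which beats every power of log log N. -/

/-! ### Dirichlet approximation -/

theorem abs_sub_mul_lt_of_div_eq {u v p Q : ℕ} (hp : 0 < p) (h : u * Q / p = v * Q / p) :
    |(u : ℤ) - v| * Q < p := by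
  have h1 := Nat.div_add_mod (u * Q) p
  have h2 := Nat.div_add_mod (v * Q) p
  have h3 := Nat.mod_lt (u * Q) hp
  have h4 := Nat.mod_lt (v * Q) hp
  rw [h] at h1
  generalize p * (v * Q / p) = w at h1 h2
  generalize u * Q % p = i at h1 h3
  generalize v * Q % p = j at h2 h4
  have h5 : |((u : ℤ) - v) * Q| < p := by
    rw [sub_mul, abs_lt]
    zify at h1 h2
    constructor <;> omega
  rwa [abs_mul, Nat.abs_cast] at h5

/-- Simultaneous Dirichlet approximation for finitely many frequencies modulo a prime. -/
theorem exists_common_difference {p : ℕ} [Fact p.Prime] (Λ : Finset (ZMod p)) {Q : ℕ}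
    (hQ : 0 < Q) (hcard : Q ^ (#Λ + 1) < p) :
    ∃ d : ℤ, d ≠ 0 ∧ |d| * Q < p ∧
      ∀ r ∈ Λ, ∃ m : ℤ, |m| * Q < p ∧ r * (d : ZMod p) = m := by
  classical
  have hp : 0 < p := (Fact.out : p.Prime).pos
  -- Including the frequency 1 makes d itself small and accounts for the exponent `#Λ + 1`.
  let Λ' : Finset (ZMod p) := insert 1 Λ
  let f : ZMod p → (Λ' → Fin Q) := fun x r =>
    ⟨(r.1 * x).val * Q / p, by
      rw [Nat.div_lt_iff_lt_mul hp, mul_comm]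
      exact Nat.mul_lt_mul_of_pos_left (ZMod.val_lt _) hQ⟩
  obtain ⟨x, y, hxy, hf⟩ : ∃ x y, x ≠ y ∧ f x = f y := by
    apply Fintype.exists_ne_map_eq_of_card_lt
    rw [Fintype.card_fun, Fintype.card_fin, Fintype.card_coe, ZMod.card]
    refine lt_of_le_of_lt (Nat.pow_le_pow_right hQ ?_) hcard
    exact card_insert_le _ _
  have key : ∀ r ∈ Λ', |((r * x).val : ℤ) - (r * y).val| * Q < p := by
    intro r hr
    apply abs_sub_mul_lt_of_div_eq hp
    have := congrFun hf ⟨r, hr⟩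
    simpa [f] using this
  have hd : (((x.val : ℤ) - y.val : ℤ) : ZMod p) = x - y := by simp
  refine ⟨(x.val : ℤ) - y.val, ?_, ?_, ?_⟩
  · intro h
    rw [h] at hd
    exact hxy (sub_eq_zero.mp (by simpa using hd.symm))
  · simpa using key 1 (mem_insert_self _ _)
  · intro r hr
    refine ⟨((r * x).val : ℤ) - (r * y).val, key r (mem_insert_of_mem hr), ?_⟩
    rw [hd]
    simp [mul_sub]

/-! ### Fourier analysis of solution counts -/

/-- The number of `(x, y, z) ∈ A³` with `x + z - 2y = s`. -/
def solutionCount (A : Finset ℤ) (s : ℤ) : ℕ :=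
  #{v ∈ A ×ˢ A ×ˢ A | v.1 + v.2.2 - 2 * v.2.1 = s}

/-- The exponential sum of `A` at the frequency `r` modulo `p`. -/
noncomputable def expSum (p : ℕ) [NeZero p] (A : Finset ℤ) (r : ZMod p) : ℂ :=
  ∑ a ∈ A, ZMod.stdAddChar (r * (a : ZMod p))

theorem norm_expSum_le (p : ℕ) [NeZero p] (A : Finset ℤ) (r : ZMod p) :
    ‖expSum p A r‖ ≤ #A := by
  refine (norm_sum_le _ _).trans ?_
  simp [AddChar.norm_apply]

theorem sum_stdAddChar_int (p : ℕ) [NeZero p] {k : ℤ} (hk : |k| < p) :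
    ∑ r : ZMod p, ZMod.stdAddChar (r * (k : ZMod p)) = if k = 0 then (p : ℂ) else 0 := by
  rw [AddChar.sum_mulShift _ (ZMod.isPrimitive_stdAddChar p), ZMod.card]
  have : ((k : ZMod p) = 0) ↔ k = 0 := by
    rw [ZMod.intCast_zmod_eq_zero_iff_dvd]
    exact ⟨fun h => Int.eq_zero_of_abs_lt_dvd h hk, fun h => h ▸ dvd_zero _⟩
  simp [this]

theorem expSum_parseval (p : ℕ) [NeZero p] {A : Finset ℤ} {N : ℕ}
    (hA : ∀ a ∈ A, 0 ≤ a ∧ a < N) (hN : N ≤ p) :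
    ∑ r : ZMod p, ‖expSum p A r‖ ^ 2 = p * #A := by
  have h1 : ∀ r : ZMod p, ((‖expSum p A r‖ ^ 2 : ℝ) : ℂ) =
      ∑ a ∈ A, ∑ b ∈ A, ZMod.stdAddChar (r * ((a - b : ℤ) : ZMod p)) := by
    intro r
    push_cast
    rw [← Complex.mul_conj', expSum, map_sum, sum_mul_sum]
    refine sum_congr rfl fun a _ => sum_congr rfl fun b _ => ?_
    rw [← AddChar.map_neg_eq_conj, ← AddChar.map_add_eq_mul]
    congr 1
    ring
  have h2 : ((∑ r : ZMod p, ‖expSum p A r‖ ^ 2 : ℝ) : ℂ) = ((p * #A : ℝ) : ℂ) := by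
    push_cast
    simp_rw [← Complex.ofReal_pow, h1]
    rw [sum_comm]
    have : ∀ a ∈ A, ∑ r : ZMod p, ∑ b ∈ A, ZMod.stdAddChar (r * ((a - b : ℤ) : ZMod p)) =
        (p : ℂ) := by
      intro a ha
      rw [sum_comm]
      rw [sum_congr rfl (g := fun b => if a = b then (p : ℂ) else 0)]
      · simp [ha]
      · intro b hb
        rw [sum_stdAddChar_int]
        · simp [sub_eq_zero]
        · have := hA a ha
          have := hA b hb
          rw [abs_lt]
          constructor <;> omega
    rw [sum_congr rfl this]
    simp [mul_comm]
  exact_mod_cast h2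

/-- Orthogonality of characters; `4 * N < p` ensures that a congruence modulo p is an equality of
integers. -/
theorem sum_expSum_eq_solutionCount (p : ℕ) [NeZero p] {A : Finset ℤ} {N : ℕ}
    (hA : ∀ a ∈ A, 0 ≤ a ∧ a < N) (hN : 4 * N < p) {s : ℤ} (hs : |s| ≤ 2 * N) :
    ∑ r : ZMod p, expSum p A r * expSum p A (-2 * r) * expSum p A r *
      ZMod.stdAddChar (-(r * (s : ZMod p))) = p * solutionCount A s := by
  have h1 : ∀ r : ZMod p, expSum p A r * expSum p A (-2 * r) * expSum p A r *
      ZMod.stdAddChar (-(r * (s : ZMod p))) = ∑ v ∈ A ×ˢ A ×ˢ A,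
        ZMod.stdAddChar (r * ((v.1 + v.2.2 - 2 * v.2.1 - s : ℤ) : ZMod p)) := by
    intro r
    have expand : ∀ (f g h : ℤ → ℂ) (c : ℂ), (∑ x ∈ A, f x) * (∑ y ∈ A, g y) * (∑ z ∈ A, h z) * c =
        ∑ v ∈ A ×ˢ A ×ˢ A, f v.1 * g v.2.1 * h v.2.2 * c := by
      intro f g h c
      simp only [sum_product]
      rw [sum_mul, sum_mul, sum_mul]
      refine sum_congr rfl fun a _ => ?_
      rw [mul_sum A g, sum_mul, sum_mul]
      refine sum_congr rfl fun b _ => ?_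
      rw [mul_sum A h, sum_mul]
    unfold expSum
    rw [expand]
    refine sum_congr rfl fun v _ => ?_
    rw [← AddChar.map_add_eq_mul, ← AddChar.map_add_eq_mul, ← AddChar.map_add_eq_mul]
    congr 1
    push_cast
    ring
  simp_rw [h1]
  rw [sum_comm, solutionCount, card_filter]
  rw [Nat.cast_sum, mul_sum]
  refine sum_congr rfl fun v hv => ?_
  simp only [mem_product] at hv
  have h1 := hA _ hv.1
  have h2 := hA _ hv.2.1
  have h3 := hA _ hv.2.2
  rw [sum_stdAddChar_int]
  · simp [sub_eq_zero]
  · rw [abs_le] at hs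
    rw [abs_lt]
    constructor <;> omega

theorem norm_stdAddChar_mul_sub_one_le (p : ℕ) [NeZero p] {Q : ℕ} {m : ℤ} (hm : |m| * Q < p)
    (hQ : 0 < Q) (t : ℤ) :
    ‖(ZMod.stdAddChar (((t * m : ℤ)) : ZMod p) : ℂ) - 1‖ ≤ 2 * Real.pi * |(t : ℝ)| / Q := by
  have hp : (0 : ℝ) < p := by exact_mod_cast Nat.pos_of_ne_zero (NeZero.ne p)
  have hQ' : (0 : ℝ) < Q := by exact_mod_cast hQ
  rw [ZMod.stdAddChar_coe]
  have : (2 * ↑Real.pi * Complex.I * ((t * m : ℤ) : ℂ) / p) =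
      Complex.I * ((2 * Real.pi * (t * m) / p : ℝ) : ℂ) := by
    push_cast; ring
  rw [this]
  refine Real.norm_exp_I_mul_ofReal_sub_one_le.trans ?_
  have hm' : |(m : ℝ)| * Q ≤ p := by exact_mod_cast hm.le
  rw [Real.norm_eq_abs, abs_div, abs_mul, abs_mul, abs_mul, abs_of_pos Real.pi_pos, abs_of_pos hp,
    div_le_div_iff₀ hp hQ']
  have : 0 ≤ Real.pi * |(t : ℝ)| := by positivity
  simp only [abs_two]
  nlinarith [mul_le_mul_of_nonneg_left hm' this]

/-- The solution count is nearly invariant under shifts by multiples of a difference adapted to the large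
spectrum. -/
theorem exists_difference_solutionCount_le {p : ℕ} [Fact p.Prime] {A : Finset ℤ} {N Q : ℕ}
    {δ K : ℝ} (hA : ∀ a ∈ A, 0 ≤ a ∧ a < N) (hN : 4 * N < p) (hp2 : p ≠ 2) (hδ : 0 < δ)
    (hQ : 0 < Q)
    (hK : p * #A / δ ^ 2 ≤ K) (hQK : ∀ k : ℕ, (k : ℝ) ≤ K → Q ^ (k + 1) < p) :
    ∃ d : ℤ, d ≠ 0 ∧ |d| * Q < p ∧ ∀ t : ℤ, |t * d| ≤ 2 * N →
      (solutionCount A (t * d) : ℝ) ≤ solutionCount A 0 +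
        2 * Real.pi * |(t : ℝ)| / Q * #A ^ 2 + 2 * δ * #A := by
  classical
  have hp : p.Prime := Fact.out
  have hp0 : (0 : ℝ) < p := by exact_mod_cast hp.pos
  set F : ZMod p → ℝ := fun r => ‖expSum p A r‖ with hF
  have hpars : ∑ r, F r ^ 2 = p * #A := expSum_parseval p hA (by omega)
  let Λ : Finset (ZMod p) := {r | δ ≤ F r}
  have hΛ : (#Λ : ℝ) ≤ K := by
    refine le_trans ?_ hK
    rw [le_div_iff₀ (by positivity), ← hpars]
    calc (#Λ : ℝ) * δ ^ 2 = ∑ r ∈ Λ, δ ^ 2 := by simp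
      _ ≤ ∑ r ∈ Λ, F r ^ 2 := sum_le_sum fun r hr => by
        have : δ ≤ F r := by simpa [Λ] using hr
        gcongr
      _ ≤ ∑ r, F r ^ 2 := sum_le_sum_of_subset_of_nonneg (subset_univ _) fun _ _ _ => sq_nonneg _
  obtain ⟨d, hd0, hdQ, hd⟩ := exists_common_difference Λ hQ (hQK _ hΛ)
  refine ⟨d, hd0, hdQ, fun t ht => ?_⟩
  have hneg2 : (-2 : ZMod p) ≠ 0 := by
    rw [neg_ne_zero]
    intro h
    have h' : ((2 : ℕ) : ZMod p) = 0 := by exact_mod_cast h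
    rw [ZMod.natCast_eq_zero_iff] at h'
    exact hp2 ((Nat.prime_dvd_prime_iff_eq hp Nat.prime_two).mp h')
  have hpars2 : ∑ r, F (-2 * r) ^ 2 = p * #A := by
    rw [← hpars]
    exact Fintype.sum_equiv (Equiv.mulLeft₀ (-2 : ZMod p) hneg2) _ _ fun _ => rfl
  have hcs : ∑ r, F r * F (-2 * r) ≤ p * #A := by
    have h1 : ∀ r, F r * F (-2 * r) ≤ (F r ^ 2 + F (-2 * r) ^ 2) / 2 := fun r => by
      nlinarith [sq_nonneg (F r - F (-2 * r))]
    calc _ ≤ ∑ r, (F r ^ 2 + F (-2 * r) ^ 2) / 2 := sum_le_sum fun r _ => h1 r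
      _ = p * #A := by rw [← sum_div, sum_add_distrib, hpars, hpars2]; ring
  have e1 := sum_expSum_eq_solutionCount p hA hN ht
  have e0 := sum_expSum_eq_solutionCount p hA hN (s := 0) (by simp)
  set ε : ℝ := 2 * Real.pi * |(t : ℝ)| / Q with hε
  have hε0 : 0 ≤ ε := by have := Real.pi_pos; positivity
  -- Two factors are kept for Parseval. The third is at most `#A` on the large spectrum, where the
  -- character is near 1, and less than δ off it.
  have hterm : ∀ r : ZMod p, ‖(expSum p A r * expSum p A (-2 * r) * expSum p A r) *
      (ZMod.stdAddChar (-(r * ((t * d : ℤ) : ZMod p))) - 1)‖ ≤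
      F r * F (-2 * r) * (ε * #A + 2 * δ) := by
    intro r
    have hFr : 0 ≤ F r := norm_nonneg _
    have hF2 : 0 ≤ F (-2 * r) := norm_nonneg _
    have hle : F r ≤ #A := norm_expSum_le p A r
    rw [norm_mul, norm_mul, norm_mul]
    change F r * F (-2 * r) * F r * _ ≤ _
    rw [mul_assoc (F r * F (-2 * r))]
    refine mul_le_mul_of_nonneg_left ?_ (mul_nonneg hFr hF2)
    by_cases hr : δ ≤ F r
    · obtain ⟨m, hm, hrm⟩ := hd r (by simpa [Λ] using hr)
      have h1 : -(r * ((t * d : ℤ) : ZMod p)) = ((-t * m : ℤ) : ZMod p) := by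
        push_cast
        rw [← hrm]; ring
      have h2 := norm_stdAddChar_mul_sub_one_le p hm hQ (-t)
      rw [h1]
      have h3 : |((-t : ℤ) : ℝ)| = |(t : ℝ)| := by push_cast; exact abs_neg _
      rw [h3] at h2
      calc _ ≤ (#A : ℝ) * ε := mul_le_mul hle h2 (norm_nonneg _) (by positivity)
        _ ≤ _ := by linarith
    · push Not at hr
      have h2 : ‖(ZMod.stdAddChar (-(r * ((t * d : ℤ) : ZMod p))) : ℂ) - 1‖ ≤ 2 := by
        refine (norm_sub_le _ _).trans ?_
        rw [AddChar.norm_apply, norm_one]; norm_num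
      calc _ ≤ δ * 2 := mul_le_mul hr.le h2 (norm_nonneg _) hδ.le
        _ ≤ _ := by
          have : 0 ≤ ε * #A := by positivity
          linarith
  have hdiff : (p : ℂ) * ((solutionCount A (t * d) : ℂ) - solutionCount A 0) =
      ∑ r : ZMod p, (expSum p A r * expSum p A (-2 * r) * expSum p A r) *
      (ZMod.stdAddChar (-(r * ((t * d : ℤ) : ZMod p))) - 1) := by
    rw [mul_sub, ← e1, ← e0, ← sum_sub_distrib]
    refine sum_congr rfl fun r _ => ?_
    simp [mul_sub]
  have hnorm := congrArg norm hdiff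
  rw [norm_mul, Complex.norm_natCast] at hnorm
  have hb : (p : ℝ) * ‖(solutionCount A (t * d) : ℂ) - solutionCount A 0‖ ≤
      p * #A * (ε * #A + 2 * δ) := by
    rw [hnorm]
    refine (norm_sum_le _ _).trans ((sum_le_sum fun r _ => hterm r).trans ?_)
    rw [← sum_mul]
    gcongr
  rw [mul_assoc] at hb
  have hb' := le_of_mul_le_mul_left hb hp0
  have h3 : ((solutionCount A (t * d) : ℂ) - solutionCount A 0) =
      (((solutionCount A (t * d) : ℝ) - solutionCount A 0 : ℝ) : ℂ) := by push_cast; rfl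
  rw [h3, Complex.norm_real, Real.norm_eq_abs] at hb'
  have := (le_abs_self _).trans hb'
  nlinarith

/-! ### Counting along progressions of difference d -/

/-- The number of `j < L` with `x + j d ∈ A`. -/
def hitCount (A : Finset ℤ) (L : ℕ) (d x : ℤ) : ℕ := #{j ∈ range L | x + (j : ℕ) * d ∈ A}

/-- For d ≠ 0 the map j ↦ x + jd reflects three-term progressions. -/
theorem hitCount_le_rothNumberNat {A : Finset ℤ} (hA : ThreeAPFree (A : Set ℤ)) (L : ℕ) {d : ℤ}
    (hd : d ≠ 0) (x : ℤ) : hitCount A L d x ≤ rothNumberNat L := by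
  refine ThreeAPFree.le_rothNumberNat _ ?_ (fun j hj => by simpa using (mem_filter.1 hj).1) rfl
  intro i hi j hj k hk h
  simp only [coe_filter, Set.mem_ofPred_eq] at hi hj hk
  have h' : (i : ℤ) + k = j + j := by exact_mod_cast h
  have := hA hi.2 hj.2 hk.2 (by linear_combination d * h')
  have h2 : ((i : ℤ) - j) * d = 0 := by linear_combination this
  have h3 := (mul_eq_zero.1 h2).resolve_right hd
  exact_mod_cast sub_eq_zero.1 h3

theorem le_sum_hitCount {A : Finset ℤ} {N L w : ℕ} {d : ℤ} (hA : ∀ a ∈ A, 0 ≤ a ∧ a < N)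
    (hw : |d| * L ≤ w) :
    L * #A ≤ ∑ x ∈ Ico (-w : ℤ) (N + w), hitCount A L d x := by
  simp_rw [hitCount, card_filter]
  rw [sum_comm]
  calc L * #A = ∑ j ∈ range L, #A := by simp
    _ ≤ _ := sum_le_sum fun j hj => ?_
  rw [← card_filter]
  refine card_le_card_of_injOn (fun a => a - (j : ℕ) * d) ?_ (fun a _ b _ h => by simpa using h)
  intro a ha
  have hj' : (j : ℤ) ≤ L := by exact_mod_cast (mem_range.1 hj).le
  have hjd : |(j : ℤ) * d| ≤ w := by
    rw [abs_mul, Nat.abs_cast, mul_comm]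
    exact (mul_le_mul_of_nonneg_left hj' (abs_nonneg d)).trans hw
  rw [abs_le] at hjd
  have := hA a ha
  simp only [coe_filter, mem_Ico, Set.mem_ofPred_eq, sub_add_cancel]
  refine ⟨⟨by linarith, by linarith⟩, ha⟩

/-- Only 2w starting points lie outside [0, N), each contributing at most r. -/
theorem le_sum_hitCount_Ico {A : Finset ℤ} {N L w r : ℕ} {d : ℤ} (hA : ∀ a ∈ A, 0 ≤ a ∧ a < N)
    (hw : |d| * L ≤ w) (hr : ∀ x, hitCount A L d x ≤ r) :
    L * #A ≤ ∑ x ∈ Ico (0 : ℤ) N, hitCount A L d x + 2 * w * r := by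
  refine (le_sum_hitCount hA hw).trans ?_
  have hsub : Ico (0 : ℤ) N ⊆ Ico (-w : ℤ) (N + w) :=
    Ico_subset_Ico (by simp) (by simp)
  rw [← sum_sdiff hsub, add_comm]
  gcongr
  refine (sum_le_card_nsmul _ _ r fun x _ => hr x).trans ?_
  rw [card_sdiff_of_subset hsub, Int.card_Ico, Int.card_Ico, smul_eq_mul]
  gcongr
  omega

/-- Union bound: each of x, x + e, x + 2e leaves S for at most b values of x < N - 2D. -/
theorem card_le_dilate_count {S : Finset ℤ} {N D b e : ℕ} (hb : #(Ico (0 : ℤ) N \ S) ≤ b)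
    (he : e < D) :
    N ≤ #{x ∈ Ico (0 : ℤ) N | x ∈ S ∧ x + e ∈ S ∧ x + 2 * e ∈ S} + 2 * D + 3 * b := by
  classical
  let B : ℕ → Finset ℤ := fun i =>
    (Ico (0 : ℤ) ((N : ℤ) - 2 * D)).filter fun x => x + (i : ℤ) ∉ S
  have hbad : ∀ i : ℕ, i ≤ 2 * D → #(B i) ≤ b := by
    intro i hi
    refine le_trans (card_le_card_of_injOn (fun x => x + (i : ℤ)) ?_
      (fun a _ b _ h => by simpa using h)) hb
    intro x hx
    simp only [B, coe_filter, mem_Ico, Set.mem_ofPred_eq] at hx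
    simp only [coe_sdiff, Set.mem_sdiff, mem_coe, mem_Ico]
    refine ⟨⟨by omega, by omega⟩, hx.2⟩
  have hcov : Ico (0 : ℤ) ((N : ℤ) - 2 * D) ⊆
      {x ∈ Ico (0 : ℤ) N | x ∈ S ∧ x + e ∈ S ∧ x + 2 * e ∈ S} ∪ (B 0 ∪ (B e ∪ B (2 * e))) := by
    intro x hx
    have hx' := mem_Ico.1 hx
    simp only [B, mem_union, mem_filter, hx, true_and]
    have h1 : x ∈ Ico (0 : ℤ) N := by
      rw [mem_Ico]; omega
    simp only [h1, true_and]
    push_cast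
    rw [add_zero]
    tauto
  have h := card_le_card hcov
  rw [Int.card_Ico] at h
  have h0 := hbad 0 (by omega)
  have h1 := hbad e (by omega)
  have h2 := hbad (2 * e) (by omega)
  have u1 := card_union_le {x ∈ Ico (0 : ℤ) N | x ∈ S ∧ x + e ∈ S ∧ x + 2 * e ∈ S}
    (B 0 ∪ (B e ∪ B (2 * e)))
  have u2 := card_union_le (B 0) (B e ∪ B (2 * e))
  have u3 := card_union_le (B e) (B (2 * e))
  omega

/-- Weighted progressions `x, x + e, x + 2e` are controlled by shifted solution counts. -/
theorem sum_hitCount_mul_le (A : Finset ℤ) (L : ℕ) (d : ℤ) (G : Finset (ℤ × ℕ)) :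
    ∑ g ∈ G, hitCount A L d g.1 * hitCount A L d (g.1 + g.2) * hitCount A L d (g.1 + 2 * g.2) ≤
      ∑ j ∈ range L ×ˢ range L ×ˢ range L,
        solutionCount A (((j.1 : ℤ) + j.2.2 - 2 * j.2.1) * d) := by
  classical
  have h1 : ∀ g ∈ G, hitCount A L d g.1 * hitCount A L d (g.1 + g.2) *
      hitCount A L d (g.1 + 2 * g.2) = ∑ j ∈ range L ×ˢ range L ×ˢ range L,
        if g.1 + j.1 * d ∈ A ∧ g.1 + g.2 + j.2.1 * d ∈ A ∧ g.1 + 2 * g.2 + j.2.2 * d ∈ A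
        then 1 else 0 := by
    intro g _
    rw [← card_filter, mul_assoc]
    unfold hitCount
    rw [← card_product, ← card_product]
    congr 1
    ext j
    simp only [mem_product, mem_filter]
    tauto
  rw [sum_congr rfl h1, sum_comm]
  refine sum_le_sum fun j _ => ?_
  rw [← card_filter]
  -- For fixed j, the first two entries of the triple determine (x, e).
  refine card_le_card_of_injOn (fun g => (g.1 + j.1 * d, g.1 + g.2 + j.2.1 * d,
    g.1 + 2 * g.2 + j.2.2 * d)) ?_ ?_
  · intro g hg
    simp only [coe_filter, Set.mem_ofPred_eq] at hg
    simp only [coe_filter, Set.mem_ofPred_eq, mem_product]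
    exact ⟨hg.2, by ring⟩
  · intro g _ g' _ h
    simp only [Prod.mk.injEq] at h
    obtain ⟨h1, h2, -⟩ := h
    have e1 : g.1 = g'.1 := by linarith
    refine Prod.ext e1 ?_
    have : (g.2 : ℤ) = g'.2 := by rw [e1] at h2; linarith
    exact_mod_cast this

/-- Otherwise no window exceeds the mean αL by much, so few fall below half of it, and the rich
windows in progression contradict the bound L³E. -/
theorem le_rothNumberNat_of_solutionCount_le {A : Finset ℤ} {N L w : ℕ} {d : ℤ} {α E : ℝ}
    (hA : ∀ a ∈ A, 0 ≤ a ∧ a < N) (hfree : ThreeAPFree (A : Set ℤ)) (hα : 0 < α)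
    (hcard : (#A : ℝ) = α * N) (hL : 0 < L) (hd : d ≠ 0) (hdw : |d| * L ≤ w)
    (hw : 200 * w ≤ N) (hN : 20 ≤ N)
    (hE : ∀ t : ℤ, |t| ≤ 2 * L → (solutionCount A (t * d) : ℝ) ≤ E)
    (hEα : E < α ^ 3 * N ^ 2 / 160) :
    41 / 40 * α * L ≤ rothNumberNat L := by
  classical
  by_contra! hr
  set r := rothNumberNat L with hrdef
  have hHr : ∀ x, hitCount A L d x ≤ r := hitCount_le_rothNumberNat hfree L hd
  have hL' : (0 : ℝ) < L := by exact_mod_cast hL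
  have hN' : (20 : ℝ) ≤ N := by exact_mod_cast hN
  have hw' : (200 : ℝ) * w ≤ N := by exact_mod_cast hw
  set β : ℝ := α * L with hβ
  have hβ0 : 0 < β := mul_pos hα hL'
  have hrβ : (r : ℝ) < 41 / 40 * β := by rw [hβ]; linarith
  let S : Finset ℤ := {x ∈ Ico (0 : ℤ) N | β ≤ 2 * (hitCount A L d x : ℝ)}
  have hSsub : S ⊆ Ico (0 : ℤ) N := filter_subset _ _
  have hcompl : #(Ico (0 : ℤ) N \ S) + #S = N := by
    rw [card_sdiff_add_card_eq_card hSsub, Int.card_Ico]; simp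
  have hcompl' : (#(Ico (0 : ℤ) N \ S) : ℝ) + #S = N := by exact_mod_cast hcompl
  have hlow : (L : ℝ) * #A ≤ ∑ x ∈ Ico (0 : ℤ) N, (hitCount A L d x : ℝ) + 2 * w * r := by
    exact_mod_cast le_sum_hitCount_Ico hA hdw hHr
  have hup : ∑ x ∈ Ico (0 : ℤ) N, (hitCount A L d x : ℝ) ≤
      #(Ico (0 : ℤ) N \ S) * (β / 2) + #S * (41 / 40 * β) := by
    rw [← sum_sdiff hSsub]
    refine add_le_add ?_ ?_
    · rw [← nsmul_eq_mul]
      refine sum_le_card_nsmul _ _ _ fun x hx => ?_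
      simp only [S, mem_sdiff, mem_filter, not_and, not_le] at hx
      linarith [hx.2 hx.1]
    · rw [← nsmul_eq_mul]
      refine sum_le_card_nsmul _ _ _ fun x _ => ?_
      exact le_trans (by exact_mod_cast hHr x) hrβ.le
  set b := #(Ico (0 : ℤ) N \ S) with hbdef
  -- From N ≤ b/2 + (41/40)(N - b) + (41/4000)N, so 0.525 b ≤ 0.03525 N.
  have hb : (b : ℝ) ≤ 68 / 1000 * N := by
    have h2 : (2 : ℝ) * w * r ≤ N / 100 * (41 / 40 * β) := by
      have hr0 : (0 : ℝ) ≤ r := Nat.cast_nonneg _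
      calc (2 : ℝ) * w * r ≤ N / 100 * r := by
            refine mul_le_mul_of_nonneg_right ?_ hr0; linarith
        _ ≤ _ := by gcongr
    have h3 : β * N ≤ β * (b / 2 + 41 / 40 * #S + 41 / 4000 * N) := by
      have : (L : ℝ) * #A = β * N := by rw [hcard, hβ]; ring
      linarith
    have h4 := le_of_mul_le_mul_left h3 hβ0
    linarith
  set D := N / 4 with hD
  have hD1 : (N : ℝ) / 4 - 3 / 4 ≤ D := by
    have : N ≤ 4 * D + 3 := by omega
    have : (N : ℝ) ≤ 4 * D + 3 := by exact_mod_cast this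
    linarith
  have hD2 : (D : ℝ) ≤ N / 4 := by
    have : 4 * D ≤ N := by omega
    have : 4 * (D : ℝ) ≤ N := by exact_mod_cast this
    linarith
  let G : Finset (ℤ × ℕ) := {g ∈ Ico (0 : ℤ) N ×ˢ range D |
    g.1 ∈ S ∧ g.1 + g.2 ∈ S ∧ g.1 + 2 * g.2 ∈ S}
  have hG : (D : ℝ) * (N - 2 * D - 3 * b) ≤ #G := by
    have hGc : #G = ∑ e ∈ range D,
        #{x ∈ Ico (0 : ℤ) N | x ∈ S ∧ x + e ∈ S ∧ x + 2 * e ∈ S} := by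
      simp only [G, card_filter]
      rw [sum_product_right]
    rw [hGc, Nat.cast_sum]
    have : (D : ℝ) * (N - 2 * D - 3 * b) = ∑ e ∈ range D, ((N : ℝ) - 2 * D - 3 * b) := by
      rw [sum_const, card_range, nsmul_eq_mul]
    rw [this]
    refine sum_le_sum fun e he => ?_
    have h := card_le_dilate_count (S := S) (N := N) (D := D) (b := b) le_rfl (mem_range.1 he)
    have h' : (N : ℝ) ≤ #{x ∈ Ico (0 : ℤ) N | x ∈ S ∧ x + e ∈ S ∧ x + 2 * e ∈ S} +
      2 * D + 3 * b := by exact_mod_cast h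
    linarith
  -- The 160 in the hypothesis on E is this 20 times the 2³ from (β/2)³.
  have hG' : (N : ℝ) ^ 2 / 20 ≤ #G := by
    refine le_trans ?_ hG
    have h1 : (2125 / 10000 : ℝ) * N ≤ D := by linarith
    have h2 : (296 / 1000 : ℝ) * N ≤ N - 2 * D - 3 * b := by linarith
    calc (N : ℝ) ^ 2 / 20 ≤ (2125 / 10000 * N) * (296 / 1000 * N) := by nlinarith
      _ ≤ _ := mul_le_mul h1 h2 (by positivity) (by positivity)
  have hsum := sum_hitCount_mul_le A L d G
  have hsum' : ∑ g ∈ G, (hitCount A L d g.1 : ℝ) * hitCount A L d (g.1 + g.2) *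
      hitCount A L d (g.1 + 2 * g.2) ≤ ∑ j ∈ range L ×ˢ range L ×ˢ range L,
        (solutionCount A (((j.1 : ℤ) + j.2.2 - 2 * j.2.1) * d) : ℝ) := by exact_mod_cast hsum
  have hright : ∑ j ∈ range L ×ˢ range L ×ˢ range L,
        (solutionCount A (((j.1 : ℤ) + j.2.2 - 2 * j.2.1) * d) : ℝ) ≤ L ^ 3 * E := by
    refine (sum_le_card_nsmul _ _ E fun j hj => ?_).trans ?_
    · simp only [mem_product, mem_range] at hj
      apply hE
      rw [abs_le]
      constructor <;> omega
    · simp only [card_product, card_range, nsmul_eq_mul]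
      push_cast
      exact le_of_eq (by ring)
  have hleft : (#G : ℝ) * (β / 2) ^ 3 ≤ ∑ g ∈ G, (hitCount A L d g.1 : ℝ) *
      hitCount A L d (g.1 + g.2) * hitCount A L d (g.1 + 2 * g.2) := by
    rw [← nsmul_eq_mul]
    refine card_nsmul_le_sum _ _ _ fun g hg => ?_
    have hS : ∀ x ∈ S, β / 2 ≤ (hitCount A L d x : ℝ) := fun x hx => by
      have := (mem_filter.1 hx).2
      linarith
    obtain ⟨-, h1, h2, h3⟩ := mem_filter.1 hg
    have h1 := hS _ h1
    have h2 := hS _ h2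
    have h3 := hS _ h3
    rw [pow_succ, sq]
    gcongr
  have h5 : (N : ℝ) ^ 2 / 20 * (β / 2) ^ 3 ≤ L ^ 3 * E :=
    (mul_le_mul_of_nonneg_right hG' (by positivity)).trans (hleft.trans (hsum'.trans hright))
  have h6 : (N : ℝ) ^ 2 / 20 * (β / 2) ^ 3 = L ^ 3 * (α ^ 3 * N ^ 2 / 160) := by
    rw [hβ]; ring
  rw [h6] at h5
  exact absurd (le_of_mul_le_mul_left h5 (by positivity)) (not_le.2 hEα)

/-! ### The density increment -/

theorem solutionCount_zero_le {A : Finset ℤ} (hA : ThreeAPFree (A : Set ℤ)) :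
    solutionCount A 0 ≤ #A := by
  have key : ∀ v ∈ ({v ∈ A ×ˢ A ×ˢ A | v.1 + v.2.2 - 2 * v.2.1 = 0} : Finset (ℤ × ℤ × ℤ)),
      v.1 ∈ A ∧ v.2.1 = v.1 ∧ v.2.2 = v.1 := by
    intro v hv
    simp only [mem_filter, mem_product] at hv
    obtain ⟨⟨h1, h2, h3⟩, h⟩ := hv
    have := hA h1 h2 h3 (by linarith)
    exact ⟨h1, this.symm, by linarith⟩
  refine card_le_card_of_injOn Prod.fst (fun v hv => (key v hv).1) ?_
  intro v hv u hu h
  obtain ⟨-, h1, h2⟩ := key v hv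
  obtain ⟨-, h3, h4⟩ := key u hu
  exact Prod.ext h (Prod.ext (by rw [h1, h3, h]) (by rw [h2, h4, h]))

theorem exists_int_threeAPFree (N : ℕ) : ∃ A : Finset ℤ, (∀ a ∈ A, 0 ≤ a ∧ a < N) ∧
    ThreeAPFree (A : Set ℤ) ∧ #A = rothNumberNat N := by
  obtain ⟨t, ht, hcard, hfree⟩ := rothNumberNat_spec N
  refine ⟨t.map Nat.castEmbedding, ?_, ?_, by rw [card_map, hcard]⟩
  · intro a ha
    obtain ⟨n, hn, rfl⟩ := mem_map.1 ha
    have := mem_range.1 (ht hn)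
    simpa using this
  · intro a ha b hb c hc h
    obtain ⟨x, hx, rfl⟩ := mem_map.1 (mem_coe.1 ha)
    obtain ⟨y, hy, rfl⟩ := mem_map.1 (mem_coe.1 hb)
    obtain ⟨z, hz, rfl⟩ := mem_map.1 (mem_coe.1 hc)
    simp only [Nat.castEmbedding_apply] at h ⊢
    exact_mod_cast hfree hx hy hz (by exact_mod_cast h)

theorem rothNumberNat_increment_of_eq {N L : ℕ} {α : ℝ} (hα0 : 0 < α) (hα1 : α ≤ 1) (hL : 0 < L)
    (hN : 0 < N) (hdens : (rothNumberNat N : ℝ) = α * N)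
    (hbig : 10 ^ 9 / α ^ 3 * Real.log (10 ^ 9 * L / α) ≤ Real.log N) :
    41 / 40 * α * L ≤ rothNumberNat L := by
  obtain ⟨A, hA, hfree, hcard⟩ := exists_int_threeAPFree N
  have hcard' : (#A : ℝ) = α * N := by rw [hcard, hdens]
  obtain ⟨p, hp, hp1, hp2⟩ := Nat.exists_prime_lt_and_le_two_mul (4 * N) (by omega)
  have := Fact.mk hp
  have hN0 : (0 : ℝ) < N := by exact_mod_cast hN
  have hL1 : (1 : ℝ) ≤ L := by exact_mod_cast hL
  have hp2' : (p : ℝ) ≤ 8 * N := by exact_mod_cast (by omega : p ≤ 8 * N)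
  have hLα : (1 : ℝ) ≤ L / α := by rw [le_div_iff₀ hα0]; linarith
  have hα3 : α ^ 3 ≤ 1 := pow_le_one₀ hα0.le hα1
  have hlog0 : 0 ≤ Real.log (10 ^ 9 * L / α) := by
    apply Real.log_nonneg
    rw [mul_div_assoc]; linarith
  have hNbig : 800 ≤ α ^ 2 * N := by
    have h1 : 2 * Real.log (10 ^ 9 * L / α) ≤ Real.log N := by
      refine le_trans ?_ hbig
      refine mul_le_mul_of_nonneg_right ?_ hlog0
      rw [le_div_iff₀ (by positivity)]
      linarith
    have h2 : Real.log ((10 ^ 9 * L / α) ^ 2) ≤ Real.log N := by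
      rw [Real.log_pow]; exact_mod_cast h1
    have h3 := (Real.log_le_log_iff (by positivity) hN0).1 h2
    rw [div_pow, div_le_iff₀ (by positivity)] at h3
    nlinarith
  -- With δ and Q so chosen, the two error terms are each at most α³N²/1600; the trivial solutions
  -- contribute at most α³N²/800 by `hNbig`.
  set δ : ℝ := α ^ 2 * N / 3200 with hδ
  set Q : ℕ := ⌈25600 * (L / α)⌉₊ with hQ
  have hQ1 : 25600 * (L / α) ≤ Q := Nat.le_ceil _
  have hQ2 : (Q : ℝ) ≤ 10 ^ 9 * L / α := by
    have := Nat.ceil_lt_add_one (by positivity : 0 ≤ 25600 * (L / α))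
    rw [mul_div_assoc]
    linarith
  have hQ0 : (0 : ℝ) < Q := by linarith
  have hQL : 25600 * (L : ℝ) ≤ α * Q := by
    have := mul_le_mul_of_nonneg_left hQ1 hα0.le
    rwa [show α * (25600 * (L / α)) = 25600 * (L : ℝ) by field_simp] at this
  have hQL' : 25600 * (L : ℝ) ≤ Q := by nlinarith
  have hK : p * #A / δ ^ 2 ≤ 81920000 / α ^ 3 := by
    rw [hcard', div_le_div_iff₀ (by positivity) (by positivity), hδ]
    calc p * (α * N) * α ^ 3 ≤ 8 * N * (α * N) * α ^ 3 := by gcongr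
      _ = 81920000 * (α ^ 2 * N / 3200) ^ 2 := by ring
  obtain ⟨d, hd0, hdQ, hd⟩ := exists_difference_solutionCount_le (p := p) (δ := δ) hA hp1
    (by omega) (by positivity) (by exact_mod_cast hQ0) hK (by
      intro k hk
      have h1 : Real.log ((Q : ℝ) ^ (k + 1)) ≤ Real.log N := by
        rw [Real.log_pow]
        refine le_trans ?_ hbig
        refine mul_le_mul ?_ (Real.log_le_log hQ0 hQ2) (Real.log_nonneg (by linarith))
          (by positivity)
        rw [le_div_iff₀ (by positivity)] at hk ⊢
        push_cast
        linarith
      have h2 := (Real.log_le_log_iff (by positivity) hN0).1 h1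
      have h3 : Q ^ (k + 1) ≤ N := by exact_mod_cast h2
      omega)
  have hdL : 3200 * (|(d : ℝ)| * L) ≤ N := by
    have h1 : |(d : ℝ)| * Q ≤ p := by exact_mod_cast hdQ.le
    have h2 := mul_le_mul_of_nonneg_left hQL' (abs_nonneg (d : ℝ))
    linarith
  refine le_rothNumberNat_of_solutionCount_le (w := d.natAbs * L) hA hfree hα0 hcard' hL hd0
    (by push_cast; rfl) ?_ ?_ (E := α * N + α / 1600 * (α * N) ^ 2 + 2 * δ * (α * N)) ?_ ?_
  · have : (200 : ℝ) * (|(d : ℝ)| * L) ≤ N := by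
      have : 0 ≤ |(d : ℝ)| * L := by positivity
      linarith
    have h : (200 : ℤ) * (|d| * L) ≤ N := by exact_mod_cast this
    zify
    exact h
  · have : (20 : ℝ) ≤ N := by nlinarith
    exact_mod_cast this
  · intro t ht
    have ht' : |(t : ℝ)| ≤ 2 * L := by exact_mod_cast ht
    have htd : |t * d| ≤ 2 * N := by
      have : |(t : ℝ)| * |(d : ℝ)| ≤ 2 * N := by
        calc |(t : ℝ)| * |(d : ℝ)| ≤ 2 * L * |(d : ℝ)| := by gcongr
          _ ≤ 2 * N := by
            have : 0 ≤ |(d : ℝ)| * L := by positivity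
            linarith
      rw [abs_mul]
      exact_mod_cast this
    refine (hd t htd).trans ?_
    rw [hcard']
    have h0 : (solutionCount A 0 : ℝ) ≤ α * N := by
      rw [← hcard']; exact_mod_cast solutionCount_zero_le hfree
    have hε : 2 * Real.pi * |(t : ℝ)| / Q ≤ α / 1600 := by
      rw [div_le_div_iff₀ hQ0 (by norm_num)]
      have hpi := Real.pi_lt_four
      have : Real.pi * |(t : ℝ)| ≤ 4 * (2 * L) :=
        mul_le_mul hpi.le ht' (abs_nonneg _) (by norm_num)
      linarith
    gcongr
  · have h1 : 800 * (α * N) ≤ α ^ 3 * N ^ 2 := by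
      have := mul_le_mul_of_nonneg_right hNbig (by positivity : 0 ≤ α * N)
      linarith
    have h2 : α / 1600 * (α * N) ^ 2 = α ^ 3 * N ^ 2 / 1600 := by ring
    have h3 : 2 * δ * (α * N) = α ^ 3 * N ^ 2 / 1600 := by rw [hδ]; ring
    rw [h2, h3]
    have : 0 < α ^ 3 * (N : ℝ) ^ 2 := by positivity
    linarith

/-- If a 3AP-free subset of `{0, …, N - 1}` has density `α`, then `{0, …, L - 1}` has a 3AP-free
subset of density at least `41 α / 40`, provided `log N` is large in terms of `log L` and `α`. -/
theorem rothNumberNat_increment {N L : ℕ} {α : ℝ} (hα0 : 0 < α) (hL : 0 < L)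
    (hN : 0 < N) (hdens : α * N ≤ rothNumberNat N)
    (hbig : 10 ^ 9 / α ^ 3 * Real.log (10 ^ 9 * L / α) ≤ Real.log N) :
    41 / 40 * α * L ≤ rothNumberNat L := by
  have hN0 : (0 : ℝ) < N := by exact_mod_cast hN
  have hL1 : (1 : ℝ) ≤ L := by exact_mod_cast hL
  -- Pass to the exact density γ ≥ α: the size condition only weakens as the density grows.
  set γ : ℝ := rothNumberNat N / N with hγ
  have hαγ : α ≤ γ := by rwa [hγ, le_div_iff₀ hN0]
  have hγ1 : γ ≤ 1 := by
    rw [hγ, div_le_one hN0]; exact_mod_cast rothNumberNat_le N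
  have hγ0 : 0 < γ := hα0.trans_le hαγ
  have h1 : (1 : ℝ) ≤ 10 ^ 9 * L / γ := by
    rw [le_div_iff₀ hγ0]; linarith
  have h2 : 41 / 40 * γ * L ≤ rothNumberNat L := by
    refine rothNumberNat_increment_of_eq hγ0 hγ1 hL hN (by rw [hγ]; field_simp)
      (le_trans ?_ hbig)
    refine mul_le_mul ?_ (Real.log_le_log (by positivity) ?_) (Real.log_nonneg h1) (by positivity)
    · gcongr
    · gcongr
  refine le_trans ?_ h2
  gcongr

/-! ### Iteration and asymptotics -/

/-- Here m bounds the number of increments before the density would exceed 1; each multiplies the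
bound on log N by at most (2·10⁹/α)⁴. -/
theorem log_le_of_le_rothNumberNat (m : ℕ) : ∀ (N : ℕ) (α : ℝ), 0 < N → 0 < α → α ≤ 1 →
    α * N ≤ rothNumberNat N → 1 < α * (41 / 40) ^ m →
    Real.log N ≤ (2 * 10 ^ 9 / α) ^ (4 * (m + 1)) := by
  induction m with
  | zero => intro N α _ _ h1 _ h2; linarith
  | succ m ih =>
    intro N α hN hα0 hα1 hdens hm
    by_contra! hlt
    set D : ℝ := 2 * 10 ^ 9 / α with hD
    have hD1 : 2 * 10 ^ 9 ≤ D := by rw [hD, le_div_iff₀ hα0]; linarith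
    set y : ℝ := D ^ (4 * (m + 1)) with hy
    have hyD : D ≤ y := le_self_pow₀ (by linarith) (by omega)
    -- L is just above exp y, so that log L violates the inductive bound y.
    set L : ℕ := ⌊Real.exp y⌋₊ + 1 with hL
    have hL1 : Real.exp y < L := by rw [hL]; exact_mod_cast Nat.lt_floor_add_one _
    have hL0 : (0 : ℝ) < L := (Real.exp_pos _).trans hL1
    have hL2 : (L : ℝ) ≤ Real.exp (y + 1) := by
      have h1 : (⌊Real.exp y⌋₊ : ℝ) ≤ Real.exp y := Nat.floor_le (Real.exp_pos _).le
      have h2 : (1 : ℝ) ≤ Real.exp y := Real.one_le_exp (by linarith)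
      have h3 : (2 : ℝ) ≤ Real.exp 1 := by linarith [Real.add_one_le_exp (1 : ℝ)]
      rw [Real.exp_add, hL]
      push_cast
      nlinarith
    have hlogL : Real.log (10 ^ 9 * L / α) ≤ 2 * y := by
      have h1 : Real.log (10 ^ 9 * L / α) = Real.log (D / 2) + Real.log L := by
        rw [← Real.log_mul (by positivity) hL0.ne']
        congr 1
        rw [hD]; ring
      have h2 : Real.log (D / 2) ≤ D / 2 - 1 := Real.log_le_sub_one_of_pos (by positivity)
      have h3 : Real.log L ≤ y + 1 := by
        rw [Real.log_le_iff_le_exp hL0]; exact hL2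
      linarith
    have hinc := rothNumberNat_increment (L := L) hα0 (by omega) hN hdens (by
      refine le_trans ?_ hlt.le
      have h1 : D ^ (4 * (m + 1 + 1)) = D ^ 4 * y := by rw [hy, ← pow_add]; congr 1; ring
      have h2 : 10 ^ 9 / α ^ 3 * 2 ≤ D ^ 4 := by
        have h3 : 10 ^ 9 / α ^ 3 * 2 ≤ D ^ 3 := by
          rw [hD, div_pow, div_mul_eq_mul_div]
          gcongr
          norm_num
        exact h3.trans (pow_le_pow_right₀ (by linarith) (by norm_num))
      rw [h1]
      calc 10 ^ 9 / α ^ 3 * Real.log (10 ^ 9 * L / α) ≤ 10 ^ 9 / α ^ 3 * (2 * y) := by gcongr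
        _ = 10 ^ 9 / α ^ 3 * 2 * y := by ring
        _ ≤ D ^ 4 * y := by gcongr)
    have hα' : 41 / 40 * α ≤ 1 := by
      have : (rothNumberNat L : ℝ) ≤ L := by exact_mod_cast rothNumberNat_le L
      have h2 : 41 / 40 * α * L ≤ 1 * L := by linarith
      exact le_of_mul_le_mul_right h2 hL0
    have hrec := ih L (41 / 40 * α) (by omega) (by positivity) hα' hinc (by
      rw [pow_succ] at hm; linarith)
    have h1 : (2 * 10 ^ 9 / (41 / 40 * α)) ^ (4 * (m + 1)) ≤ y := by
      rw [hy, hD]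
      gcongr
      linarith
    have h2 : y < Real.log L := by rwa [Real.lt_log_iff_exp_lt hL0]
    linarith

theorem rThree_eq_rothNumberNat (N : ℕ) : rThree N = rothNumberNat N := by
  have h : Icc 1 N = Ico 1 (N + 1) := rfl
  rw [rThree, h, addRothNumber_Ico, Nat.add_sub_cancel]

theorem tendsto_log_log_natCast :
    Filter.Tendsto (fun N : ℕ => Real.log (Real.log (N : ℝ))) Filter.atTop Filter.atTop :=
  Real.tendsto_log_atTop.comp (Real.tendsto_log_atTop.comp tendsto_natCast_atTop_atTop)

theorem eventually_mul_log_sq_lt (B : ℝ) (hB : 0 < B) :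
    ∀ᶠ x : ℝ in Filter.atTop, B * Real.log x ^ 2 < x := by
  have h := (Real.isLittleO_pow_log_id_atTop (n := 2)).bound (c := 1 / (2 * B)) (by positivity)
  filter_upwards [h, Filter.eventually_gt_atTop 0] with x hx hx0
  rw [Real.norm_of_nonneg (sq_nonneg _), id, Real.norm_of_nonneg hx0.le] at hx
  calc B * Real.log x ^ 2 ≤ B * (1 / (2 * B) * x) := by gcongr
    _ = x / 2 := by field_simp
    _ < x := by linarith

theorem eventually_rThree_le (c : ℝ) (hc : 0 < c) :
    ∀ᶠ N : ℕ in Filter.atTop, (rThree N : ℝ) ≤ N / Real.log (Real.log (N : ℝ)) ^ c := by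
  have hκ : 0 < Real.log (41 / 40) := Real.log_pos (by norm_num)
  set κ := c / Real.log (41 / 40) with hκdef
  have hκ0 : 0 < κ := by positivity
  set Λ := Real.log (2 * 10 ^ 9) with hΛ
  have hΛ0 : 0 < Λ := Real.log_pos (by norm_num)
  have hev := tendsto_log_log_natCast.eventually
    ((eventually_mul_log_sq_lt (4 * (κ + 2) * (Λ + c)) (by positivity)).and
      (Filter.eventually_ge_atTop (Real.exp 1)))
  filter_upwards [hev, Filter.eventually_gt_atTop 0] with N hN hN0
  rw [rThree_eq_rothNumberNat]
  set x := Real.log (Real.log (N : ℝ)) with hx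
  obtain ⟨hN1, hN2⟩ := hN
  have hx1 : 1 < x := by linarith [Real.add_one_le_exp (1 : ℝ)]
  have hx0 : 0 < x := by linarith
  have hlx : 1 ≤ Real.log x := by rwa [Real.le_log_iff_exp_le hx0]
  have hxc : 0 < x ^ c := Real.rpow_pos_of_pos hx0 c
  by_contra! hlt
  -- Enough increments to lift density x^(-c) above 1. As m = O(log x), the iteration bound gives x
  -- = O(log² x), false for large x.
  set m : ℕ := ⌊κ * Real.log x⌋₊ + 1 with hm
  have hm1 : κ * Real.log x < m := by rw [hm]; exact_mod_cast Nat.lt_floor_add_one _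
  have hm2 : (m : ℝ) ≤ κ * Real.log x + 1 := by
    rw [hm]; push_cast
    linarith [Nat.floor_le (by positivity : 0 ≤ κ * Real.log x)]
  have hpow : 1 < (x ^ c)⁻¹ * (41 / 40 : ℝ) ^ m := by
    rw [inv_mul_eq_div, one_lt_div hxc, ← Real.log_lt_log_iff hxc (by positivity), Real.log_pow,
      Real.log_rpow hx0]
    calc c * Real.log x = κ * Real.log x * Real.log (41 / 40) := by rw [hκdef]; field_simp
      _ < _ := by gcongr
  have hkey := log_le_of_le_rothNumberNat m N (x ^ c)⁻¹ hN0 (by positivity)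
    (inv_le_one_of_one_le₀ (Real.one_le_rpow hx1.le hc.le))
    (by rw [inv_mul_eq_div]; exact hlt.le) hpow
  have hlogN : 0 < Real.log N := by
    by_contra! h
    have h0 : 0 ≤ Real.log N := Real.log_natCast_nonneg N
    have : x = 0 := by rw [hx, le_antisymm h h0, Real.log_zero]
    linarith
  have h1 := Real.log_le_log hlogN hkey
  rw [← hx, Real.log_pow, div_inv_eq_mul, Real.log_mul (by norm_num) hxc.ne', Real.log_rpow hx0,
    ← hΛ] at h1
  push_cast at h1
  have h2 : (m : ℝ) + 1 ≤ (κ + 2) * Real.log x := by linarith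
  have h3 : Λ + c * Real.log x ≤ (Λ + c) * Real.log x := by nlinarith
  have h4 : 4 * ((m : ℝ) + 1) * (Λ + c * Real.log x) ≤
      4 * ((κ + 2) * Real.log x) * ((Λ + c) * Real.log x) := by gcongr
  have h5 : 4 * ((κ + 2) * Real.log x) * ((Λ + c) * Real.log x) =
    4 * (κ + 2) * (Λ + c) * Real.log x ^ 2 := by ring
  linarith

theorem one_le_rThree {N : ℕ} (hN : 0 < N) : 1 ≤ rThree N := by
  have h : #({1} : Finset ℕ) ≤ rThree N := by
    refine ThreeAPFree.le_addRothNumber ?_ (by simpa using Nat.succ_le_of_lt hN)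
    rw [coe_singleton]
    exact threeAPFree_singleton 1
  simpa using h

theorem rThree_le (N : ℕ) : rThree N ≤ N := by
  rw [rThree_eq_rothNumberNat]
  exact rothNumberNat_le N

theorem theorem1p9 :
    (∃ ω : ℕ → ℝ, Filter.Tendsto ω Filter.atTop Filter.atTop ∧
      ∀ N : ℕ, 3 ≤ N →
        (rThree N : ℝ) ≤ (N : ℝ) / (Real.log (Real.log (N : ℝ))) ^ (ω N)) ∧
    (∀ c : ℝ, 0 < c → ∃ C : ℝ, 0 < C ∧ ∃ N₀ : ℕ, 3 ≤ N₀ ∧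
      ∀ N : ℕ, N₀ ≤ N →
        (rThree N : ℝ) ≤ C * (N : ℝ) / (Real.log (Real.log (N : ℝ))) ^ c) := by
  classical
  -- This exponent gives equality when log log N > 1; otherwise the exponent 0 leaves the trivial
  -- bound N.
  refine ⟨⟨fun N => if 1 < Real.log (Real.log (N : ℝ)) then
    Real.logb (Real.log (Real.log (N : ℝ))) (N / rThree N) else 0, ?_, ?_⟩, ?_⟩
  · rw [Filter.tendsto_atTop]
    intro b
    have hc : 0 < max b 1 := by positivity
    filter_upwards [eventually_rThree_le _ hc,
      tendsto_log_log_natCast.eventually (Filter.eventually_gt_atTop 1),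
      Filter.eventually_gt_atTop 0] with N hN hx hN0
    have hr : (0 : ℝ) < rThree N := by exact_mod_cast one_le_rThree hN0
    have hN' : (0 : ℝ) < N := by exact_mod_cast hN0
    rw [if_pos hx]
    refine (le_max_left b 1).trans ?_
    rw [Real.le_logb_iff_rpow_le hx (by positivity), le_div_iff₀ hr]
    rwa [le_div_iff₀ (Real.rpow_pos_of_pos (by linarith) _), mul_comm] at hN
  · intro N hN
    have hr : (0 : ℝ) < rThree N := by exact_mod_cast one_le_rThree (by omega : 0 < N)
    have hN' : (0 : ℝ) < N := by exact_mod_cast (by omega : 0 < N)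
    simp only
    split_ifs with h
    · rw [Real.rpow_logb (by linarith) h.ne' (by positivity), div_div_cancel₀ hN'.ne']
    · rw [Real.rpow_zero, div_one]
      exact_mod_cast rThree_le N
  · intro c hc
    obtain ⟨N₀, hN₀⟩ := Filter.eventually_atTop.1 (eventually_rThree_le c hc)
    refine ⟨1, one_pos, max N₀ 3, le_max_right _ _, fun N hN => ?_⟩
    rw [one_mul]
    exact hN₀ N (le_trans (le_max_left _ _) hN)
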